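/- Let $R>0$ and let $g,a,b:\mathbf R^2\to\mathbf R$ be smooth functions such that $g>0$, the center of mass of every circle of radius $R$ with mass density $g$ is the center of that circle, and $$a_{x_2}(x_1,x_2)-b_{x_1}(x_1,x_2)=\frac1R\,g(x_1+R,x_2).$$ Consider the Lagrangian, homogeneous of degree $1$ in the velocity $v=(r\cos\alpha,r\sin\alpha)$, $$L(x,v)=r\Bigl(\int_0^{\alpha+\pi/2}\cos(\alpha-\phi)\,g(x_1+R\cos\phi,\,x_2+R\sin\phi)\,d\phi+a(x)\cos\alpha+b(x)\sin\alpha\Bigr)$$ (the general form of a Finsler metric in the plane whose geodesics are the positively oriented circles of radius $R$), the Finsler length $\mathcal L(\gamma)=\int L(\gamma(t),\gamma'(t))\,dt$, and the area form $\omega=-\frac1R\,g(u,v)\,du\wedge dv$ on the space of circles of radius $R$, a circle being identified with its center $(u,v)$. Then all positively oriented circles of radius $R$ have the same Finsler length $C$. Moreover, let $\gamma$ be a smooth regular oriented simple closed curve, with unit tangent vector $(\cos\alpha,\sin\alpha)$ at its point $(x_1,x_2)$, and let $\Gamma(-R)$ be the parallel curve formed by the points $(x_1-R\sin\alpha,\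 x_2+R\cos\alpha)$ and parametrized by $\gamma$. Let $S(\Gamma(-R))$ be the signed $\omega$-area bounded by $\Gamma(-R)$, that is, the integral over $\Gamma(-R)$ of a $1$-form $\sigma$ with $d\sigma=\omega$. If $\gamma$ is positively (counterclockwise) oriented, then $$\mathcal L(\gamma)=S(\Gamma(-R))+C,$$ and if $\gamma$ is negatively (clockwise) oriented, then $$\mathcal L(\gamma)=S(\Gamma(-R))-C.$$ -/

import Mathlib

open Set Filter Topology MeasureTheory

noncomputable section

/-! The Euclidean plane is identified with `ℂ`, the point `(x₁, x₂)` being `x₁ + i x₂`;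
the rotation `J (v₁, v₂) = (-v₂, v₁)` is multiplication by `Complex.I`. The positively oriented
circle with centre `c` and radius `R` is `circleMap c R : θ ↦ c + R exp (i θ)` on `[0, 2π]`. -/

namespace MagneticCrofton

/-- The centre of mass of the circle with centre `x` and radius `R`, with mass density `g`. -/
def circleCenterOfMass (g : ℂ → ℝ) (R : ℝ) (x : ℂ) : ℂ :=
  (∫ φ in (0 : ℝ)..2 * Real.pi, g (circleMap x R φ))⁻¹ •
    ∫ φ in (0 : ℝ)..2 * Real.pi, g (circleMap x R φ) • circleMap x R φ

/-- The data `(g, a, b)` of a Lagrangian whose extremals are the positively oriented circles of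
radius `R`: `g` is a positive density such that the centre of mass of every circle of radius `R`
is its centre, and `∂a/∂x₂ - ∂b/∂x₁ = g (x₁ + R, x₂) / R`. -/
structure IsMagneticData (R : ℝ) (g a b : ℂ → ℝ) : Prop where
  smooth_g : ContDiff ℝ (⊤ : ℕ∞) g
  smooth_a : ContDiff ℝ (⊤ : ℕ∞) a
  smooth_b : ContDiff ℝ (⊤ : ℕ∞) b
  pos : ∀ x, 0 < g x
  centerOfMass : ∀ x, circleCenterOfMass g R x = x
  curl : ∀ x : ℂ, fderiv ℝ a x Complex.I - fderiv ℝ b x 1 = 1 / R * g (x + R)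

/-- The Lagrangian `L (x, v)`, homogeneous of degree one in `v = r (cos α, sin α)`:
`r (∫ φ from 0 to α + π/2 of cos (α - φ) g (x + R (cos φ, sin φ)) + a x cos α + b x sin α)`.
For data as above the value does not depend on the choice of the polar angle `α` of `v`. -/
def lagrangian (R : ℝ) (g a b : ℂ → ℝ) (x v : ℂ) : ℝ :=
  ‖v‖ * ((∫ φ in (0 : ℝ)..(v.arg + Real.pi / 2),
      Real.cos (v.arg - φ) * g (circleMap x R φ)) +
    a x * Real.cos v.arg + b x * Real.sin v.arg)

/-- The Finsler length, with Lagrangian `L`, of the curve `γ` on `[0, T]`. -/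
def finslerLength (L : ℂ → ℂ → ℝ) (γ : ℝ → ℂ) (T : ℝ) : ℝ :=
  ∫ t in (0 : ℝ)..T, L (γ t) (deriv γ t)

/-- `γ` is a smooth regular `T`-periodic parametrization of a simple closed curve. -/
structure IsSimpleClosedCurve (γ : ℝ → ℂ) (T : ℝ) : Prop where
  period_pos : 0 < T
  smooth : ContDiff ℝ (⊤ : ℕ∞) γ
  periodic : Function.Periodic γ T
  regular : ∀ t, deriv γ t ≠ 0
  simple : InjOn γ (Ico 0 T)

/-- The interior of a closed curve: the points of the complement of the curve whose connected
component in that complement is bounded. -/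
def insideOf (γ : ℝ → ℂ) : Set ℂ :=
  {z | z ∈ (range γ)ᶜ ∧ Bornology.IsBounded (connectedComponentIn (range γ)ᶜ z)}

/-- Counterclockwise orientation: the interior lies to the left of the curve. -/
def IsPositivelyOriented (γ : ℝ → ℂ) : Prop :=
  ∀ t, ∀ᶠ s : ℝ in 𝓝[>] 0, γ t + s * (Complex.I * deriv γ t) ∈ insideOf γ

/-- Clockwise orientation: the interior lies to the right of the curve. -/
def IsNegativelyOriented (γ : ℝ → ℂ) : Prop :=
  ∀ t, ∀ᶠ s : ℝ in 𝓝[>] 0, γ t - s * (Complex.I * deriv γ t) ∈ insideOf γ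

/-- The unit vector coorienting `γ`: the normal `n` for which `(n, γ')` is a positive frame.
It is the outward normal of a counterclockwise simple closed curve. -/
def coorientation (γ : ℝ → ℂ) (t : ℝ) : ℂ :=
  -(Complex.I * (deriv γ t / (‖deriv γ t‖ : ℂ)))

/-- The parallel curve `Γ(s)` at signed distance `s` from `γ`. -/
def parallelCurve (γ : ℝ → ℂ) (s : ℝ) (t : ℝ) : ℂ :=
  γ t + s * coorientation γ t

/-- The cross product `[z, w] = z₁ w₂ - z₂ w₁`. -/
def cross (z w : ℂ) : ℝ := z.re * w.im - z.im * w.re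

/-- The signed area bounded by the closed curve `Γ` (on `[0, T]`, singularities and
self-intersections allowed) with respect to the area form `ω = h du ∧ dv`. It is the integral of `ω`
over the cone `(s, t) ↦ s Γ(t)`, that is, the integral over `Γ` of the primitive
`(∫ s in 0..1, s h (s z)) (u dv - v du)` of `ω`; for `h = 1` this is `(u dv - v du) / 2`. -/
def signedArea (h : ℂ → ℝ) (Γ : ℝ → ℂ) (T : ℝ) : ℝ :=
  ∫ t in (0 : ℝ)..T, (∫ s in (0 : ℝ)..1, s * h (s * Γ t)) * cross (Γ t) (deriv Γ t)

/-- The coefficient of the area form `ω = -(1/R) g du ∧ dv` on the space of circles of radius `R`,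
a circle being identified with its centre `(u, v)`. -/
def omegaDensity (R : ℝ) (g : ℂ → ℝ) (z : ℂ) : ℝ := -(1 / R) * g z

end MagneticCrofton

end

/-! On pairs (x, α) of a point and a direction angle, the Hilbert form λ = p · dx, with p = ∂L/∂v,
restricts along the lift (γ, α) of a curve to L dt. Let c(x, α) be the centre of the circle through
x with direction α. The key fact is dλ = c*ω: the angular derivative of p is g(c) times the normal,
and the curl of p in x is -g(c)/R (`exists_hasFDerivAt_momentum`). Hence λ - c*σ is closed, where σ
is the radial primitive of ω (`reducedHilbertForm_closed`).

With α ranging over ℝ, the domain ℂ × ℝ is convex, so λ - c*σ = dF. The centre-of-mass condition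
makes the form 2π-periodic in α, so F(x, α + 2π) = F(x, α) + C with one constant C for all (x, α)
(`exists_primitive_reducedHilbertForm`). Along a lifted curve, c traces Γ(-R), so length minus
signed area is the increment of F (`finslerLength_eq_signedArea_add`).

For a closed curve this increment depends only on the total turning of α. On a circle of radius R it
is C and the area vanishes because c is constant. For a simple closed curve the turning is ±2π by
Hopf's Umlaufsatz (`angle_add_period`), the sign being read off at a lowest point. -/

noncomputable section

namespace MagneticCrofton

/-! ### Differentiation of integrals depending on parameters -/

section ParametricIntegral

variable {H E : Type*} [NormedAddCommGroup H] [NormedSpace ℝ H] [ProperSpace H]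
  [NormedAddCommGroup E] [NormedSpace ℝ E]

/-- Differentiation under the integral sign for a continuously differentiable integrand. -/
theorem hasFDerivAt_intervalIntegral_of_continuous {F : H → ℝ → E} {F' : H → ℝ → H →L[ℝ] E}
    (hF : Continuous F.uncurry) (hF' : Continuous F'.uncurry)
    (h : ∀ x t, HasFDerivAt (F · t) (F' x t) x) (a b : ℝ) (x₀ : H) :
    HasFDerivAt (fun x => ∫ t in a..b, F x t) (∫ t in a..b, F' x₀ t) x₀ := by
  obtain ⟨M, hM⟩ := ((isCompact_closedBall x₀ 1).prod
    (isCompact_uIcc (a := a) (b := b))).exists_bound_of_continuousOn hF'.continuousOn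
  have hc : ∀ x, Continuous (F x) := fun x => hF.comp (by fun_prop : Continuous fun t => (x, t))
  have hc' : Continuous (F' x₀) := hF'.comp (by fun_prop : Continuous fun t => (x₀, t))
  refine intervalIntegral.hasFDerivAt_integral_of_dominated_of_fderiv_le (bound := fun _ => M)
    (Metric.ball_mem_nhds x₀ one_pos) (.of_forall fun x => (hc x).aestronglyMeasurable)
    ((hc x₀).intervalIntegrable _ _) hc'.aestronglyMeasurable
    (.of_forall fun t ht x hx => ?_) intervalIntegrable_const
    (.of_forall fun t _ x _ => h x t)
  exact hM (x, t) ⟨Metric.ball_subset_closedBall hx, uIoc_subset_uIcc ht⟩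

/-- The derivative of an integral with respect to parameters in the integrand and in the upper
limit. -/
theorem hasFDerivAt_intervalIntegral_prod [CompleteSpace E] {F : H → ℝ → E}
    {F' : H → ℝ → H →L[ℝ] E}
    (hF : Continuous F.uncurry) (hF' : Continuous F'.uncurry)
    (h : ∀ x t, HasFDerivAt (F · t) (F' x t) x) (a : ℝ) (q : H × ℝ) :
    HasFDerivAt (fun p : H × ℝ => ∫ t in a..p.2, F p.1 t)
      ((∫ t in a..q.2, F' q.1 t).coprod (ContinuousLinearMap.toSpanSingleton ℝ (F q.1 q.2))) q := by
  have := hasStrictFDerivAt_uncurry_coprod (𝕜 := ℝ) (u := q)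
    (f := fun x b => ∫ t in a..b, F x t) (f₁ := fun x b => ∫ t in a..b, F' x t)
    (f₂ := fun x b => ContinuousLinearMap.toSpanSingleton ℝ (F x b))
    (.of_forall fun v => hasFDerivAt_intervalIntegral_of_continuous hF hF' h a v.2 v.1)
    (.of_forall fun v => ?_)
    (intervalIntegral.continuous_parametric_primitive_of_continuous hF').continuousAt ?_
  · exact this.hasFDerivAt
  · have hc : Continuous (F v.1) := hF.comp (by fun_prop : Continuous fun t => (v.1, t))
    exact (intervalIntegral.integral_hasDerivAt_right (hc.intervalIntegrable _ _)
      (hc.stronglyMeasurableAtFilter _ _) hc.continuousAt).hasFDerivAt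
  · exact ((ContinuousLinearMap.toSpanSingletonCLE (𝕜 := ℝ) (E := E)).continuous.comp
      hF).continuousAt

end ParametricIntegral

/-! ### The radial primitive of an area form -/

/-- The coefficient of the radial primitive of the area form `h du ∧ dv`. -/
def radialWeight (h : ℂ → ℝ) (z : ℂ) : ℝ := ∫ s in (0 : ℝ)..1, s * h (s * z)

/-- The derivative of s² h(sz) in s is 2s h(sz) + s² dh(sz)(z); integrating over [0, 1] gives the
identity. It says precisely that K (u dv - v du), with K = `radialWeight h`, has exterior derivative
h du ∧ dv. -/
theorem exists_hasFDerivAt_radialWeight {h : ℂ → ℝ} (hh : ContDiff ℝ (⊤ : ℕ∞) h) (z : ℂ) :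
    ∃ K' : ℂ →L[ℝ] ℝ, HasFDerivAt (radialWeight h) K' z ∧ 2 * radialWeight h z + K' z = h z := by
  have hd : Differentiable ℝ h := hh.differentiable (by simp)
  have hcd : Continuous (fderiv ℝ h) := hh.continuous_fderiv (by simp)
  have hc : Continuous h := hh.continuous
  have hl : ∀ (s : ℝ) (x : ℂ), HasFDerivAt (fun x : ℂ => (s : ℂ) * x)
      (s • ContinuousLinearMap.id ℝ ℂ) x := fun s x => by
    simp_rw [← Complex.real_smul]
    exact (hasFDerivAt_id (𝕜 := ℝ) x).const_smul s
  have hFd : ∀ (x : ℂ) (s : ℝ), HasFDerivAt (fun x : ℂ => s * h (s * x))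
      ((s * s) • fderiv ℝ h (s * x)) x := fun x s => by
    convert! (((hd _).hasFDerivAt.comp x (hl s x)).const_mul s) using 1
    ext v
    simp [mul_assoc]
  have hF' : Continuous (Function.uncurry fun (x : ℂ) (s : ℝ) =>
      (s * s) • fderiv ℝ h (s * x)) := by
    unfold Function.uncurry
    fun_prop
  refine ⟨_, hasFDerivAt_intervalIntegral_of_continuous (F := fun (x : ℂ) (s : ℝ) => s * h (s * x))
    (by unfold Function.uncurry; fun_prop) hF' hFd 0 1 z, ?_⟩
  have hi : Continuous fun s : ℝ => (s * s) • fderiv ℝ h (s * z) := by fun_prop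
  rw [ContinuousLinearMap.intervalIntegral_apply (hi.intervalIntegrable _ _), radialWeight,
    ← intervalIntegral.integral_const_mul,
    ← intervalIntegral.integral_add
      (Continuous.intervalIntegrable (by fun_prop) _ _)
      (Continuous.intervalIntegrable (by fun_prop) _ _),
    intervalIntegral.integral_eq_sub_of_hasDerivAt (f := fun s : ℝ => s ^ 2 * h (s * z))]
  · simp
  · intro s _
    have h1 : HasDerivAt (fun s : ℝ => (s : ℂ) * z) z s := by
      simpa using (Complex.ofRealCLM.hasDerivAt (x := s)).mul_const z
    have h2 := ((hd (s * z)).hasFDerivAt.comp_hasDerivAt s h1)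
    convert! (hasDerivAt_pow 2 s).mul h2 using 1
    simp
    ring
  · exact Continuous.intervalIntegrable (by fun_prop) _ _

/-! ### The Hilbert form -/

/-- The centre of the positively oriented circle of radius `R` through `q.1` with tangent direction
`exp (i q.2)` there. -/
def tangentCenter (R : ℝ) (q : ℂ × ℝ) : ℂ := q.1 + R * (Complex.I * Complex.exp (q.2 * Complex.I))

/-- The vector of momenta `∂L/∂v` in the direction `exp (i q.2)` at the point `q.1`. -/
def momentum (R : ℝ) (g a b : ℂ → ℝ) (q : ℂ × ℝ) : ℂ :=
  (∫ φ in (0 : ℝ)..(q.2 + Real.pi / 2), g (circleMap q.1 R φ) • Complex.exp (φ * Complex.I)) +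
    (a q.1 + b q.1 * Complex.I)

/-- The derivative of `tangentCenter R` at `q`. -/
def tangentCenterDeriv (R : ℝ) (q : ℂ × ℝ) : ℂ × ℝ →L[ℝ] ℂ :=
  ContinuousLinearMap.fst ℝ ℂ ℝ +
    (ContinuousLinearMap.snd ℝ ℂ ℝ).smulRight (-(R * Complex.exp (q.2 * Complex.I)))

theorem hasDerivAt_exp_mul_I (α : ℝ) : HasDerivAt (fun α : ℝ => Complex.exp (α * Complex.I))
    (Complex.exp (α * Complex.I) * Complex.I) α := by
  have h1 : HasDerivAt (fun s : ℝ => (s : ℂ) * Complex.I) Complex.I α := by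
    simpa using (Complex.ofRealCLM.hasDerivAt (x := α)).mul_const Complex.I
  exact h1.cexp

theorem hasFDerivAt_tangentCenter (R : ℝ) (q : ℂ × ℝ) :
    HasFDerivAt (tangentCenter R) (tangentCenterDeriv R q) q := by
  have h1 := ((hasDerivAt_exp_mul_I q.2).const_mul (R * Complex.I)).hasFDerivAt.comp q
    (hasFDerivAt_snd (𝕜 := ℝ) (p := q))
  convert! (hasFDerivAt_fst (𝕜 := ℝ) (p := q)).add h1 using 1
  · ext p
    simp [tangentCenter, mul_assoc]
  · ext v
    · simp [tangentCenterDeriv]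
    · simp [tangentCenterDeriv]
      linear_combination (-R * Complex.exp (q.2 * Complex.I)) * Complex.I_mul_I

/-- The antisymmetrisation of a bilinear form on the plane given by a linear map. -/
theorem inner_sub_inner_eq_cross (A : ℂ →L[ℝ] ℂ) (v w : ℂ) :
    inner ℝ (A v) w - inner ℝ (A w) v = ((A 1).im - (A Complex.I).re) * cross v w := by
  have h : ∀ v : ℂ, A v = v.re • A 1 + v.im • A Complex.I := fun v => by
    rw [← map_smul, ← map_smul, ← map_add]
    congr 1
    simp
  rw [h v, h w]
  simp [Complex.inner, cross]
  ring

/-- Contracting the vanishing 3-form A ∧ [·, ·] of the plane with z. It computes dK ∧ (u dv - v du)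
for the radial primitive. -/
theorem cross_identity (A : ℂ →L[ℝ] ℝ) (z v w : ℂ) :
    A v * cross z w - A w * cross z v = A z * cross v w := by
  have h : ∀ v : ℂ, A v = v.re * A 1 + v.im * A Complex.I := fun v => by
    rw [← smul_eq_mul, ← smul_eq_mul, ← map_smul, ← map_smul, ← map_add]
    congr 1
    simp
  rw [h v, h w, h z]
  simp only [cross]
  ring

variable {R : ℝ} {g a b : ℂ → ℝ}

theorem continuous_density_smul_exp (H : IsMagneticData R g a b) (x : ℂ) :
    Continuous fun φ : ℝ => g (circleMap x R φ) • Complex.exp (φ * Complex.I) := by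
  have := H.smooth_g.continuous
  unfold circleMap
  fun_prop

/-- The centre of mass minus x is R/M times this integral, where M > 0 is the total mass. -/
theorem integral_smul_exp_eq_zero (hR : 0 < R) (H : IsMagneticData R g a b) (x : ℂ) :
    ∫ φ in (0 : ℝ)..2 * Real.pi, g (circleMap x R φ) • Complex.exp (φ * Complex.I) = 0 := by
  have hc := H.centerOfMass x
  have hgc : Continuous fun φ => g (circleMap x R φ) :=
    H.smooth_g.continuous.comp (continuous_circleMap x R)
  set M := ∫ φ in (0 : ℝ)..2 * Real.pi, g (circleMap x R φ) with hM
  have hpos : 0 < M := intervalIntegral.intervalIntegral_pos_of_pos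
    (hgc.intervalIntegrable _ _) (fun φ => H.pos _) Real.two_pi_pos
  rw [circleCenterOfMass, ← hM, inv_smul_eq_iff₀ hpos.ne'] at hc
  have h2 : ∫ φ in (0 : ℝ)..2 * Real.pi, g (circleMap x R φ) • circleMap x R φ =
      M • x + R • ∫ φ in (0 : ℝ)..2 * Real.pi,
        g (circleMap x R φ) • Complex.exp (φ * Complex.I) := by
    rw [hM, ← intervalIntegral.integral_smul_const, ← intervalIntegral.integral_smul,
      ← intervalIntegral.integral_add]
    · refine intervalIntegral.integral_congr fun φ _ => ?_
      simp [circleMap]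
      ring
    · exact (hgc.smul continuous_const).intervalIntegrable _ _
    · exact ((continuous_density_smul_exp H x).const_smul R).intervalIntegrable _ _
  rw [h2] at hc
  simpa [hR.ne'] using hc

/-- A full turn adds to the momentum the integral of g e^{iφ} over the whole circle, which vanishes
by the centre-of-mass condition. -/
theorem momentum_add_two_pi (hR : 0 < R) (H : IsMagneticData R g a b) (x : ℂ) (α : ℝ) :
    momentum R g a b (x, α + 2 * Real.pi) = momentum R g a b (x, α) := by
  have hcont := continuous_density_smul_exp H x
  have hper : Function.Periodic
      (fun φ : ℝ => g (circleMap x R φ) • Complex.exp (φ * Complex.I)) (2 * Real.pi) := fun φ => by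
    simp only [periodic_circleMap x R φ]
    congr 1
    push_cast
    rw [add_mul, Complex.exp_periodic]
  have h := hper.intervalIntegral_add_eq (α + Real.pi / 2) 0
  rw [zero_add, integral_smul_exp_eq_zero hR H] at h
  simp only [momentum]
  rw [← intervalIntegral.integral_add_adjacent_intervals (hcont.intervalIntegrable _ _)
    (hcont.intervalIntegrable (α + Real.pi / 2) _), show α + 2 * Real.pi + Real.pi / 2 =
    α + Real.pi / 2 + 2 * Real.pi by ring, h, add_zero]

theorem continuous_momentum (H : IsMagneticData R g a b) : Continuous (momentum R g a b) := by
  have hg := H.smooth_g.continuous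
  have ha := H.smooth_a.continuous
  have hb := H.smooth_b.continuous
  have : Continuous fun q : ℂ × ℝ => ∫ φ in (0 : ℝ)..(q.2 + Real.pi / 2),
      g (circleMap q.1 R φ) • Complex.exp (φ * Complex.I) := by
    apply intervalIntegral.continuous_parametric_intervalIntegral_of_continuous
    · unfold Function.uncurry circleMap
      fun_prop
    · fun_prop
  unfold momentum
  fun_prop

theorem momentum_add_int_mul_two_pi (hR : 0 < R) (H : IsMagneticData R g a b) (x : ℂ) (α : ℝ)
    (n : ℤ) : momentum R g a b (x, α + n * (2 * Real.pi)) = momentum R g a b (x, α) :=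
  Function.Periodic.int_mul (f := fun α => momentum R g a b (x, α))
    (fun α => momentum_add_two_pi hR H x α) n α

/-- Degree-one homogeneity in the form L = p · v. By periodicity any polar angle may replace
`v.arg`, so a continuous angle along a curve can be used despite the branch cut. -/
theorem lagrangian_eq_inner (hR : 0 < R) (H : IsMagneticData R g a b) (x : ℂ) {v : ℂ} {α : ℝ}
    (hv : v ≠ 0) (hα : v = ‖v‖ * Complex.exp (α * Complex.I)) :
    lagrangian R g a b x v = inner ℝ (momentum R g a b (x, α)) v := by
  obtain ⟨n, hn⟩ : ∃ n : ℤ, α = v.arg + n * (2 * Real.pi) := by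
    have h1 : Complex.exp (α * Complex.I) = Complex.exp (v.arg * Complex.I) := by
      have h2 := (Complex.norm_mul_exp_arg_mul_I v).trans hα
      exact (mul_left_cancel₀ (by simpa using hv) h2).symm
    obtain ⟨n, hn⟩ := Complex.exp_eq_exp_iff_exists_int.1 h1
    refine ⟨n, ?_⟩
    have := congrArg Complex.im hn
    simpa using this
  rw [hn, momentum_add_int_mul_two_pi hR H]
  have hcont := continuous_density_smul_exp H x
  have hint : ∫ φ in (0 : ℝ)..(v.arg + Real.pi / 2),
      Real.cos (v.arg - φ) * g (circleMap x R φ) =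
      inner ℝ (∫ φ in (0 : ℝ)..(v.arg + Real.pi / 2),
        g (circleMap x R φ) • Complex.exp (φ * Complex.I))
        (Complex.exp (v.arg * Complex.I)) := by
    have := (innerSL ℝ (Complex.exp (v.arg * Complex.I))).intervalIntegral_comp_comm
      (μ := volume) (hcont.intervalIntegrable 0 (v.arg + Real.pi / 2))
    rw [real_inner_comm, ← innerSL_apply_apply ℝ, ← this]
    refine intervalIntegral.integral_congr fun φ _ => ?_
    simp [Complex.inner, Real.cos_sub, Complex.exp_ofReal_mul_I_re, Complex.exp_ofReal_mul_I_im]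
    ring
  have hpolar : v = ‖v‖ • Complex.exp (v.arg * Complex.I) := by simp
  rw [lagrangian, hint, momentum]
  clear hint hα hn hv
  generalize v.arg = β, ‖v‖ = r at *
  rw [hpolar, inner_smul_right, inner_add_left, add_assoc]
  congr 2
  simp [Complex.inner, Complex.exp_ofReal_mul_I_re, Complex.exp_ofReal_mul_I_im]
  ring

/-- This accounts for the upper limit α + π/2 in the Lagrangian: there the integrand is evaluated at
the centre of the tangent circle. -/
theorem tangentCenter_eq_circleMap (R : ℝ) (q : ℂ × ℝ) :
    tangentCenter R q = circleMap q.1 R (q.2 + Real.pi / 2) := by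
  rw [tangentCenter, circleMap]
  push_cast
  rw [add_mul, Complex.exp_add, Complex.exp_pi_div_two_mul_I]
  ring

/-- The antisymmetric part of a real linear endomorphism of the plane. -/
def curlCLM : (ℂ →L[ℝ] ℂ) →L[ℝ] ℝ :=
  Complex.imCLM ∘L ContinuousLinearMap.apply ℝ ℂ (1 : ℂ) -
    Complex.reCLM ∘L ContinuousLinearMap.apply ℝ ℂ Complex.I

theorem curlCLM_apply (A : ℂ →L[ℝ] ℂ) : curlCLM A = (A 1).im - (A Complex.I).re := rfl

/-- The angular derivative comes from the upper limit of the integral. The curl in x of g(x + R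
e^{iφ}) e^{iφ} is -(1/R) times the φ-derivative of g(x + R e^{iφ}), so the curl of the integral
telescopes to boundary values. -/
theorem exists_hasFDerivAt_momentum (hR : 0 < R) (H : IsMagneticData R g a b) (q : ℂ × ℝ) :
    ∃ A : ℂ →L[ℝ] ℂ, HasFDerivAt (momentum R g a b)
      (A.coprod (ContinuousLinearMap.toSpanSingleton ℝ
        (g (tangentCenter R q) • (Complex.exp (q.2 * Complex.I) * Complex.I)))) q ∧
      (A 1).im - (A Complex.I).re = -(1 / R) * g (tangentCenter R q) := by
  have hgd : Differentiable ℝ g := H.smooth_g.differentiable (by simp)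
  have had : Differentiable ℝ a := H.smooth_a.differentiable (by simp)
  have hbd : Differentiable ℝ b := H.smooth_b.differentiable (by simp)
  have hg : Continuous g := H.smooth_g.continuous
  have hg' : Continuous (fderiv ℝ g) := H.smooth_g.continuous_fderiv (by simp)
  have hd : ∀ (x : ℂ) (φ : ℝ), HasFDerivAt
      (fun x : ℂ => g (circleMap x R φ) • Complex.exp (φ * Complex.I))
      ((fderiv ℝ g (circleMap x R φ)).smulRight (Complex.exp (φ * Complex.I))) x := fun x φ => by
    have h1 : HasFDerivAt (fun x : ℂ => circleMap x R φ) (ContinuousLinearMap.id ℝ ℂ) x := by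
      unfold circleMap
      exact (hasFDerivAt_id x).add_const _
    have h2 : HasFDerivAt (fun x : ℂ => g (circleMap x R φ))
        (fderiv ℝ g (circleMap x R φ)) x := (hgd _).hasFDerivAt.comp x h1
    exact h2.smul_const _
  have hc : Continuous (Function.uncurry fun (x : ℂ) (φ : ℝ) =>
      g (circleMap x R φ) • Complex.exp (φ * Complex.I)) := by
    unfold Function.uncurry circleMap
    fun_prop
  have hcm : Continuous fun p : ℂ × ℝ => circleMap p.1 R p.2 := by
    unfold circleMap
    fun_prop
  have hc' : Continuous (Function.uncurry fun (x : ℂ) (φ : ℝ) =>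
      (fderiv ℝ g (circleMap x R φ)).smulRight (Complex.exp (φ * Complex.I))) :=
    ((ContinuousLinearMap.smulRightL ℝ ℂ ℂ).continuous₂).comp
      ((hg'.comp hcm).prodMk (by fun_prop : Continuous fun p : ℂ × ℝ =>
        Complex.exp (p.2 * Complex.I)))
  have hshift : HasFDerivAt (fun q : ℂ × ℝ => (q.1, q.2 + Real.pi / 2))
      (ContinuousLinearMap.id ℝ (ℂ × ℝ)) q := by
    convert! (hasFDerivAt_fst (𝕜 := ℝ) (p := q)).prodMk
      ((hasFDerivAt_snd (𝕜 := ℝ) (p := q)).add_const (Real.pi / 2)) using 1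
  have hI := (hasFDerivAt_intervalIntegral_prod hc hc' hd 0 (q.1, q.2 + Real.pi / 2)).comp q hshift
  have ha : HasFDerivAt (fun q : ℂ × ℝ => (a q.1 : ℂ))
      (Complex.ofRealCLM ∘L fderiv ℝ a q.1 ∘L ContinuousLinearMap.fst ℝ ℂ ℝ) q :=
    Complex.ofRealCLM.hasFDerivAt.comp q ((had q.1).hasFDerivAt.comp q hasFDerivAt_fst)
  have hb : HasFDerivAt (fun q : ℂ × ℝ => (b q.1 : ℂ))
      (Complex.ofRealCLM ∘L fderiv ℝ b q.1 ∘L ContinuousLinearMap.fst ℝ ℂ ℝ) q :=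
    Complex.ofRealCLM.hasFDerivAt.comp q ((hbd q.1).hasFDerivAt.comp q hasFDerivAt_fst)
  have hi : Continuous fun φ : ℝ =>
      (fderiv ℝ g (circleMap q.1 R φ)).smulRight (Complex.exp (φ * Complex.I)) :=
    hc'.comp (by fun_prop : Continuous fun φ : ℝ => (q.1, φ))
  refine ⟨(∫ φ in (0 : ℝ)..(q.2 + Real.pi / 2),
      (fderiv ℝ g (circleMap q.1 R φ)).smulRight (Complex.exp (φ * Complex.I))) +
      (Complex.ofRealCLM ∘L fderiv ℝ a q.1 + (fderiv ℝ b q.1).smulRight Complex.I), ?_, ?_⟩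
  · convert! hI.add (ha.add (hb.mul_const Complex.I)) using 1
    ext v
    · simp [mul_comm]
    · simp [tangentCenter_eq_circleMap, add_mul, Complex.exp_add, Complex.exp_pi_div_two_mul_I]
  · rw [← curlCLM_apply, map_add, ← curlCLM.intervalIntegral_comp_comm (hi.intervalIntegrable _ _),
      intervalIntegral.integral_eq_sub_of_hasDerivAt
        (f := fun φ => -(1 / R) * g (circleMap q.1 R φ)), ← tangentCenter_eq_circleMap]
    -- The lower limit φ = 0 contributes g(x + R)/R, which the curl of (a, b) cancels; only the
    -- value at the centre survives.
    · have hcurl := H.curl q.1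
      simp only [curlCLM_apply]
      simp [circleMap]
      simp at hcurl
      linarith
    · intro φ _
      have h1 := ((hgd (circleMap q.1 R φ)).hasFDerivAt.comp_hasDerivAt φ
        (hasDerivAt_circleMap q.1 R φ)).const_mul (-(1 / R))
      convert! h1 using 1
      have h2 : circleMap 0 R φ * Complex.I =
          (-(R * Real.sin φ)) • (1 : ℂ) + (R * Real.cos φ) • Complex.I := by
        apply Complex.ext <;> simp [circleMap, Complex.exp_ofReal_mul_I_re,
          Complex.exp_ofReal_mul_I_im, Complex.smul_re, Complex.smul_im, -Complex.real_smul]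
      rw [h2, map_add, map_smul, map_smul, curlCLM_apply]
      simp [Complex.exp_ofReal_mul_I_re, Complex.exp_ofReal_mul_I_im]
      field_simp
      ring
    · exact (curlCLM.continuous.comp hi).intervalIntegrable _ _

/-- The cross product as a bilinear map. -/
def crossCLM : ℂ →L[ℝ] ℂ →L[ℝ] ℝ :=
  Complex.reCLM.smulRight Complex.imCLM - Complex.imCLM.smulRight Complex.reCLM

theorem crossCLM_apply (z w : ℂ) : crossCLM z w = cross z w := by
  simp [crossCLM, cross]

/-- The Hilbert form of the Lagrangian minus the pullback under `tangentCenter` of the radial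
primitive of the area form `h du ∧ dv`. -/
def reducedHilbertForm (R : ℝ) (g a b h : ℂ → ℝ) (q : ℂ × ℝ) : ℂ × ℝ →L[ℝ] ℝ :=
  innerSL ℝ (momentum R g a b q) ∘L ContinuousLinearMap.fst ℝ ℂ ℝ -
    radialWeight h (tangentCenter R q) •
      (crossCLM (tangentCenter R q) ∘L tangentCenterDeriv R q)

theorem reducedHilbertForm_apply (h : ℂ → ℝ) (q v : ℂ × ℝ) :
    reducedHilbertForm R g a b h q v = inner ℝ (momentum R g a b q) v.1 -
      radialWeight h (tangentCenter R q) *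
        cross (tangentCenter R q) (tangentCenterDeriv R q v) := by
  simp [reducedHilbertForm, crossCLM_apply]

theorem hasFDerivAt_tangentCenterDeriv (R : ℝ) (q : ℂ × ℝ) :
    HasFDerivAt (tangentCenterDeriv R) ((ContinuousLinearMap.snd ℝ ℂ ℝ).smulRight
      ((ContinuousLinearMap.snd ℝ ℂ ℝ).smulRight
        (-(R * (Complex.exp (q.2 * Complex.I) * Complex.I))))) q := by
  have h1 : HasFDerivAt (fun q : ℂ × ℝ => -(R * Complex.exp (q.2 * Complex.I)))
      ((ContinuousLinearMap.snd ℝ ℂ ℝ).smulRight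
        (-(R * (Complex.exp (q.2 * Complex.I) * Complex.I)))) q := by
    convert! ((hasDerivAt_exp_mul_I q.2).const_mul (R : ℂ)).neg.hasFDerivAt.comp q
      (hasFDerivAt_snd (𝕜 := ℝ) (p := q)) using 1
  have h2 := ((ContinuousLinearMap.smulRightL ℝ (ℂ × ℝ) ℂ
    (ContinuousLinearMap.snd ℝ ℂ ℝ)).hasFDerivAt.comp q h1).const_add
      (ContinuousLinearMap.fst ℝ ℂ ℝ)
  convert! h2 using 1
  ext <;> simp

/-- Symmetry of the derivative is closedness, that is dλ = c*ω. Horizontal pairs match through the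
curl of p, mixed pairs through its angular derivative; the second derivative of `tangentCenter` is
symmetric and drops out. -/
theorem reducedHilbertForm_closed (hR : 0 < R) (H : IsMagneticData R g a b) (q : ℂ × ℝ) :
    ∃ Ω : ℂ × ℝ →L[ℝ] ℂ × ℝ →L[ℝ] ℝ,
      HasFDerivAt (reducedHilbertForm R g a b (omegaDensity R g)) Ω q ∧
        ∀ v w, Ω v w = Ω w v := by
  obtain ⟨A, hA, hAcurl⟩ := exists_hasFDerivAt_momentum hR H q
  have hh : ContDiff ℝ (⊤ : ℕ∞) (omegaDensity R g) := contDiff_const.mul H.smooth_g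
  obtain ⟨K', hK, hKh⟩ := exists_hasFDerivAt_radialWeight hh (tangentCenter R q)
  have hZ := hasFDerivAt_tangentCenter R q
  have hD := hasFDerivAt_tangentCenterDeriv R q
  have h1 := ((innerSL ℝ (E := ℂ)).hasFDerivAt.comp q hA).clm_comp
    (hasFDerivAt_const (ContinuousLinearMap.fst ℝ ℂ ℝ) q)
  have h2 := (hK.comp q hZ).smul ((crossCLM.hasFDerivAt.comp q hZ).clm_comp hD)
  refine ⟨_, h1.sub h2, fun v w => ?_⟩
  set z := tangentCenter R q
  have e1 := inner_sub_inner_eq_cross A v.1 w.1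
  have e2 := cross_identity K' z (tangentCenterDeriv R q v) (tangentCenterDeriv R q w)
  have hr : 1 / R * R = 1 := by field_simp
  have e3 : ∀ v, tangentCenterDeriv R q v = v.1 - v.2 • (R • Complex.exp (q.2 * Complex.I)) :=
    fun v => by simp [tangentCenterDeriv, sub_eq_add_neg]
  have hin : ∀ x y : ℂ, innerSL ℝ x y = x.re * y.re + x.im * y.im := fun x y => by
    rw [innerSL_apply_apply, Complex.inner]
    simp
    ring
  simp only [Complex.inner] at e1
  simp only [omegaDensity] at hKh
  rw [hAcurl] at e1
  simp [crossCLM_apply, hin]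
  rw [e3 v, e3 w] at e2 ⊢
  clear hD h2 hA h1 hK hAcurl hZ
  generalize K' z = k₀, g z = γ, (1 / R) = r at *
  rw [show tangentCenter R q = z from rfl]
  generalize radialWeight (omegaDensity R g) z = k at *
  -- The radial identity 2K + dK(z) = h(z) eliminates dK(z).
  obtain rfl : k₀ = -r * γ - 2 * k := by linarith
  simp [cross, Complex.exp_ofReal_mul_I_re, Complex.exp_ofReal_mul_I_im] at *
  -- The last summand treats the mixed terms in dx and dα, where the 1/R of ω meets the R in the
  -- angular derivative of the centre.
  linear_combination e1 - e2 + (γ * (v.2 * (Real.cos q.2 * w.1.im - Real.sin q.2 * w.1.re) -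
    w.2 * (Real.cos q.2 * v.1.im - Real.sin q.2 * v.1.re))) * (-hr)

theorem exp_ofReal_add_two_pi_mul_I (α : ℝ) :
    Complex.exp ((α + 2 * Real.pi : ℝ) * Complex.I) = Complex.exp (α * Complex.I) := by
  push_cast
  rw [add_mul, Complex.exp_periodic]

theorem reducedHilbertForm_add_two_pi (hR : 0 < R) (H : IsMagneticData R g a b) (h : ℂ → ℝ)
    (q : ℂ × ℝ) :
    reducedHilbertForm R g a b h (q + (0, 2 * Real.pi)) = reducedHilbertForm R g a b h q := by
  obtain ⟨x, α⟩ := q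
  simp only [reducedHilbertForm, tangentCenter, tangentCenterDeriv, Prod.mk_add_mk, add_zero,
    momentum_add_two_pi hR H, exp_ofReal_add_two_pi_mul_I]

/-- Poincaré lemma on ℂ × ℝ. The form is invariant under α ↦ α + 2π, so F and its translate have the
same derivative and differ by a constant. -/
theorem exists_primitive_reducedHilbertForm (hR : 0 < R) (H : IsMagneticData R g a b) :
    ∃ F : ℂ × ℝ → ℝ,
      (∀ q, HasFDerivAt F (reducedHilbertForm R g a b (omegaDensity R g) q) q) ∧
      ∃ C, ∀ q, F (q + (0, 2 * Real.pi)) = F q + C := by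
  obtain ⟨F, hF⟩ := convex_univ.exists_forall_hasFDerivAt_of_fderiv_symmetric isOpen_univ
    (ω := reducedHilbertForm R g a b (omegaDensity R g))
    (fun q _ => by
      obtain ⟨Ω, hΩ, -⟩ := reducedHilbertForm_closed hR H q
      exact hΩ.differentiableAt.differentiableWithinAt)
    (fun q _ => by
      obtain ⟨Ω, hΩ, hs⟩ := reducedHilbertForm_closed hR H q
      rw [hΩ.fderiv]
      exact hs)
  replace hF := fun q => hF q (mem_univ q)
  refine ⟨F, hF, F (0 + (0, 2 * Real.pi)) - F 0, fun q => ?_⟩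
  have hd : ∀ q, HasFDerivAt (fun q => F (q + (0, 2 * Real.pi)) - F q) 0 q := fun q => by
    have h1 : HasFDerivAt (fun q => F (q + (0, 2 * Real.pi)))
        (reducedHilbertForm R g a b (omegaDensity R g) q) q := by
      rw [← reducedHilbertForm_add_two_pi hR H]
      exact (hF _).comp q ((hasFDerivAt_id q).add_const _)
    simpa only [sub_self] using h1.fun_sub (hF q)
  have := is_const_of_fderiv_eq_zero (fun q => (hd q).differentiableAt)
    (fun q => (hd q).fderiv) q 0
  linarith

/-! ### Length, signed area and the increment of the primitive -/

theorem parallelCurve_neg_eq_tangentCenter (γ : ℝ → ℂ) (α : ℝ → ℝ) (t : ℝ)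
    (hreg : deriv γ t ≠ 0)
    (hpol : deriv γ t = ‖deriv γ t‖ * Complex.exp (α t * Complex.I)) :
    parallelCurve γ (-R) t = tangentCenter R (γ t, α t) := by
  have h : deriv γ t / (‖deriv γ t‖ : ℂ) = Complex.exp (α t * Complex.I) := by
    rw [div_eq_iff (by simpa using hreg), mul_comm]
    exact hpol
  rw [parallelCurve, coorientation, h, tangentCenter]
  push_cast
  ring

/-- The fundamental theorem of calculus for F along t ↦ (γ t, α t): λ integrates to the length and
c*σ to the area of Γ(-R). Closedness of γ is not needed here. -/
theorem finslerLength_eq_signedArea_add (hR : 0 < R) (H : IsMagneticData R g a b)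
    {F : ℂ × ℝ → ℝ}
    (hF : ∀ q, HasFDerivAt F (reducedHilbertForm R g a b (omegaDensity R g) q) q)
    {γ : ℝ → ℂ} (hγ : ContDiff ℝ (⊤ : ℕ∞) γ) (hreg : ∀ t, deriv γ t ≠ 0) {α α' : ℝ → ℝ}
    (hα : ∀ t, HasDerivAt α (α' t) t) (hα' : Continuous α')
    (hpol : ∀ t, deriv γ t = ‖deriv γ t‖ * Complex.exp (α t * Complex.I)) (T : ℝ) :
    finslerLength (lagrangian R g a b) γ T =
      signedArea (omegaDensity R g) (parallelCurve γ (-R)) T +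
        (F (γ T, α T) - F (γ 0, α 0)) := by
  have hγd : ∀ t, HasDerivAt γ (deriv γ t) t := fun t =>
    (hγ.differentiable (by simp) t).hasDerivAt
  have hγ' : Continuous (deriv γ) := hγ.continuous_deriv (by simp)
  have hγc : Continuous γ := hγ.continuous
  have hαc : Continuous α := continuous_iff_continuousAt.2 fun t => (hα t).continuousAt
  set c : ℝ → ℂ × ℝ := fun t => (γ t, α t)
  set c' : ℝ → ℂ × ℝ := fun t => (deriv γ t, α' t)
  have hc : ∀ t, HasDerivAt c (c' t) t := fun t => (hγd t).prodMk (hα t)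
  have hΓ : parallelCurve γ (-R) = tangentCenter R ∘ c :=
    funext fun t => parallelCurve_neg_eq_tangentCenter γ α t (hreg t) (hpol t)
  have hΓd : ∀ t, HasDerivAt (tangentCenter R ∘ c) (tangentCenterDeriv R (c t) (c' t)) t :=
    fun t => (hasFDerivAt_tangentCenter R (c t)).comp_hasDerivAt t (hc t)
  have hh : ContDiff ℝ (⊤ : ℕ∞) (omegaDensity R g) := contDiff_const.mul H.smooth_g
  have hK : Continuous (radialWeight (omegaDensity R g)) := continuous_iff_continuousAt.2 fun z =>
    (exists_hasFDerivAt_radialWeight hh z).choose_spec.1.continuousAt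
  have hcc : Continuous c := hγc.prodMk hαc
  have hΓc : Continuous (tangentCenter R ∘ c) :=
    continuous_iff_continuousAt.2 fun t => (hΓd t).continuousAt
  have hΓ'c : Continuous fun t => tangentCenterDeriv R (c t) (c' t) :=
    (continuous_iff_continuousAt.2 fun t =>
      (hasFDerivAt_tangentCenterDeriv R (c t)).continuousAt.comp hcc.continuousAt).clm_apply
      (hγ'.prodMk hα')
  have hi₁ : Continuous fun t => inner ℝ (momentum R g a b (c t)) (deriv γ t) :=
    ((continuous_momentum H).comp hcc).inner hγ'
  have hi₂ : Continuous fun t => radialWeight (omegaDensity R g) (tangentCenter R (c t)) *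
      cross (tangentCenter R (c t)) (tangentCenterDeriv R (c t) (c' t)) := by
    simp only [← crossCLM_apply]
    exact (hK.comp hΓc).mul (crossCLM.continuous₂.comp (hΓc.prodMk hΓ'c))
  have hftc := intervalIntegral.integral_eq_sub_of_hasDerivAt (a := 0) (b := T)
    (fun t _ => (hF (c t)).comp_hasDerivAt t (hc t))
    (by
      simp only [reducedHilbertForm_apply]
      exact (hi₁.sub hi₂).intervalIntegrable _ _)
  simp only [reducedHilbertForm_apply] at hftc
  rw [intervalIntegral.integral_sub (hi₁.intervalIntegrable _ _)
    (hi₂.intervalIntegrable _ _)] at hftc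
  have hL : finslerLength (lagrangian R g a b) γ T =
      ∫ t in (0 : ℝ)..T, inner ℝ (momentum R g a b (c t)) (deriv γ t) :=
    intervalIntegral.integral_congr fun t _ => lagrangian_eq_inner hR H _ (hreg t) (hpol t)
  have hS : signedArea (omegaDensity R g) (parallelCurve γ (-R)) T =
      ∫ t in (0 : ℝ)..T, radialWeight (omegaDensity R g) (tangentCenter R (c t)) *
        cross (tangentCenter R (c t)) (tangentCenterDeriv R (c t) (c' t)) := by
    rw [hΓ]
    refine intervalIntegral.integral_congr fun t _ => ?_
    simp only [(hΓd t).deriv, radialWeight, Function.comp_apply]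
  rw [hL, hS]
  simp only [Function.comp_apply] at hftc
  linarith

/-- The parallel curve collapses to the centre, so the area is zero, and the direction angle t + π/2
gains 2π. -/
theorem finslerLength_circleMap (hR : 0 < R) (H : IsMagneticData R g a b) {F : ℂ × ℝ → ℝ}
    (hF : ∀ q, HasFDerivAt F (reducedHilbertForm R g a b (omegaDensity R g) q) q) {C : ℝ}
    (hC : ∀ q, F (q + (0, 2 * Real.pi)) = F q + C) (c : ℂ) :
    finslerLength (lagrangian R g a b) (circleMap c R) (2 * Real.pi) = C := by
  have hderiv : ∀ t, deriv (circleMap c R) t =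
      R * Complex.exp ((t + Real.pi / 2 : ℝ) * Complex.I) := fun t => by
    rw [deriv_circleMap, circleMap]
    push_cast
    rw [add_mul (t : ℂ), Complex.exp_add, Complex.exp_pi_div_two_mul_I]
    ring
  have hreg : ∀ t, deriv (circleMap c R) t ≠ 0 := fun t => by
    rw [hderiv]
    simpa using hR.ne'
  have hpol : ∀ t, deriv (circleMap c R) t = ‖deriv (circleMap c R) t‖ *
      Complex.exp ((t + Real.pi / 2 : ℝ) * Complex.I) := fun t => by
    rw [hderiv, norm_mul, Complex.norm_exp_ofReal_mul_I, Complex.norm_real, Real.norm_of_nonneg hR.le,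
      mul_one]
  have hconst : parallelCurve (circleMap c R) (-R) = fun _ => c := funext fun t => by
    rw [parallelCurve_neg_eq_tangentCenter _ (fun t => t + Real.pi / 2) t (hreg t) (hpol t),
      tangentCenter_eq_circleMap, circleMap, circleMap]
    push_cast
    rw [show ((t : ℂ) + Real.pi / 2 + Real.pi / 2) * Complex.I =
      t * Complex.I + Real.pi * Complex.I by ring, Complex.exp_add, Complex.exp_pi_mul_I]
    ring
  rw [finslerLength_eq_signedArea_add hR H hF (contDiff_circleMap c R) hreg
    (fun t => (hasDerivAt_id t).add_const _) continuous_const hpol, hconst]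
  have h := hC (circleMap c R 0, 0 + Real.pi / 2)
  have h2 : circleMap c R (2 * Real.pi) = circleMap c R 0 := by
    simpa using periodic_circleMap c R 0
  simp only [Prod.mk_add_mk, add_zero] at h
  have h3 : signedArea (omegaDensity R g) (fun _ => c) (2 * Real.pi) = 0 := by
    simp [signedArea, cross]
  simp only [id]
  rw [h3, h2, show 2 * Real.pi + Real.pi / 2 = 0 + Real.pi / 2 + 2 * Real.pi by ring, h]
  ring

/-! ### The rotation number of a simple closed curve -/

/-- The mean of a function over the segment from `s` to `s + u`. -/
def segmentMean (f : ℝ → ℂ) (s u : ℝ) : ℂ := ∫ τ in (0 : ℝ)..1, f (s + τ * u)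

theorem continuous_segmentMean {f : ℝ → ℂ} (hf : Continuous f) :
    Continuous fun p : ℝ × ℝ => segmentMean f p.1 p.2 := by
  unfold segmentMean
  apply intervalIntegral.continuous_parametric_intervalIntegral_of_continuous'
  unfold Function.uncurry
  fun_prop

theorem mul_segmentMean_deriv {γ : ℝ → ℂ} (hγ : Differentiable ℝ γ) (hγ' : Continuous (deriv γ))
    (s u : ℝ) : u * segmentMean (deriv γ) s u = γ (s + u) - γ s := by
  have h : ∀ τ : ℝ, HasDerivAt (fun τ : ℝ => γ (s + τ * u)) (u * deriv γ (s + τ * u)) τ :=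
    fun τ => by
      have h1 : HasDerivAt (fun τ : ℝ => s + τ * u) u τ := by
        simpa using ((hasDerivAt_id τ).mul_const u).const_add s
      rw [← Complex.real_smul]
      exact (hγ (s + τ * u)).hasDerivAt.scomp τ h1
  rw [segmentMean, ← intervalIntegral.integral_const_mul,
    intervalIntegral.integral_eq_sub_of_hasDerivAt (fun τ _ => h τ)
      (Continuous.intervalIntegrable (by fun_prop) _ _)]
  simp

/-- A continuous extension of the direction of the secant from `γ s` to `γ (s + u)` of a curve
of period `T` to the whole strip `0 ≤ u ≤ T`. -/
def secant (γ : ℝ → ℂ) (T : ℝ) (p : ℝ × ℝ) : ℂ :=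
  segmentMean (deriv γ) p.1 p.2 - segmentMean (deriv γ) (p.1 + T) (p.2 - T)

section

variable {γ : ℝ → ℂ} {T : ℝ}

/-- For 0 < u < T the two means are the chord divided by u and by u - T, so their difference is
T/(u(T - u)) times the chord: a positive multiple. -/
theorem secant_mul (hγ : Differentiable ℝ γ) (hγ' : Continuous (deriv γ))
    (hper : Function.Periodic γ T) (s u : ℝ) :
    (u * (T - u)) * secant γ T (s, u) = T * (γ (s + u) - γ s) := by
  have h1 := mul_segmentMean_deriv hγ hγ' s u
  have h2 := mul_segmentMean_deriv hγ hγ' (s + T) (u - T)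
  rw [show s + T + (u - T) = s + u by ring, hper] at h2
  push_cast at h2
  simp only [secant]
  linear_combination (T - u : ℂ) * h1 + u * h2

/-- The mean of γ' over a full period vanishes, leaving the tangent alone; at u = T the other mean
vanishes, whence the opposite sign. -/
theorem secant_zero (hγ : Differentiable ℝ γ) (hγ' : Continuous (deriv γ)) (hT : 0 < T)
    (hper : Function.Periodic γ T) (s : ℝ) : secant γ T (s, 0) = deriv γ s := by
  have h2 := mul_segmentMean_deriv hγ hγ' (s + T) (0 - T)
  rw [show s + T + (0 - T) = s by ring, hper, sub_self] at h2
  have h3 : segmentMean (deriv γ) (s + T) (0 - T) = 0 := by simpa [hT.ne'] using h2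
  simp only [secant]
  rw [h3]
  simp [segmentMean]

theorem deriv_periodic (hper : Function.Periodic γ T) : Function.Periodic (deriv γ) T := fun t => by
  rw [← deriv_comp_add_const]
  congr 1
  exact funext hper

theorem secant_period (hγ : Differentiable ℝ γ) (hγ' : Continuous (deriv γ)) (hT : 0 < T)
    (hper : Function.Periodic γ T) (s : ℝ) : secant γ T (s, T) = -deriv γ s := by
  have h2 := mul_segmentMean_deriv hγ hγ' s T
  rw [hper, sub_self] at h2
  have h3 : segmentMean (deriv γ) s T = 0 := by simpa [hT.ne'] using h2
  simp only [secant]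
  rw [h3]
  simp [segmentMean, deriv_periodic hper s]

theorem ne_of_injOn_of_periodic (hinj : InjOn γ (Ico 0 T)) (hT : 0 < T)
    (hper : Function.Periodic γ T) (s : ℝ) {u : ℝ} (hu : u ∈ Ioo 0 T) : γ (s + u) ≠ γ s := by
  intro h
  have hm : ∀ t, γ (toIcoMod hT 0 t) = γ t := fun t => by
    rw [← self_sub_toIcoDiv_zsmul]
    exact hper.sub_zsmul_eq _
  have hmem : ∀ t, toIcoMod hT 0 t ∈ Ico 0 T := fun t => by
    simpa using toIcoMod_mem_Ico hT 0 t
  have h1 := hinj (hmem _) (hmem _) ((hm _).trans (h.trans (hm _).symm))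
  rw [← self_sub_toIcoDiv_zsmul, ← self_sub_toIcoDiv_zsmul] at h1
  set m := toIcoDiv hT 0 (s + u)
  set n := toIcoDiv hT 0 s
  have h2 : u = ((m - n : ℤ) : ℝ) * T := by
    simp only [zsmul_eq_mul] at h1
    push_cast
    linarith
  have h3 : (0 : ℝ) < ((m - n : ℤ) : ℝ) := by
    by_contra hle
    nlinarith [hu.1]
  have h4 : ((m - n : ℤ) : ℝ) < 1 := by
    by_contra hle
    nlinarith [hu.2]
  have h5 : (0 : ℤ) < m - n := by exact_mod_cast h3
  have h6 : m - n < (1 : ℤ) := by exact_mod_cast h4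
  omega

theorem secant_ne_zero (hγ : Differentiable ℝ γ) (hγ' : Continuous (deriv γ)) (hT : 0 < T)
    (hper : Function.Periodic γ T) (hreg : ∀ t, deriv γ t ≠ 0) (hinj : InjOn γ (Ico 0 T))
    (s : ℝ) {u : ℝ} (hu : u ∈ Icc 0 T) : secant γ T (s, u) ≠ 0 := by
  rcases eq_or_lt_of_le hu.1 with rfl | h0
  · rw [secant_zero hγ hγ' hT hper]
    exact hreg s
  rcases eq_or_lt_of_le hu.2 with rfl | h1
  · rw [secant_period hγ hγ' hT hper]
    exact neg_ne_zero.2 (hreg s)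
  · intro h
    have := secant_mul hγ hγ' hper s u
    rw [h, mul_zero] at this
    have hT' : (T : ℂ) ≠ 0 := by exact_mod_cast hT.ne'
    exact ne_of_injOn_of_periodic hinj hT hper s ⟨h0, h1⟩
      (sub_eq_zero.1 ((mul_eq_zero.1 this.symm).resolve_left hT'))

end

/-- A continuous logarithm of a nonvanishing continuous function on the plane. -/
theorem exists_continuous_exp_eq {f : ℝ × ℝ → ℂ} (hf : Continuous f) (h0 : ∀ p, f p ≠ 0) :
    ∃ ℓ : ℝ × ℝ → ℂ, Continuous ℓ ∧ ∀ p, Complex.exp (ℓ p) = f p := by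
  -- The plane is simply connected, so f lifts through the covering exp of the punctured plane.
  obtain ⟨ℓ, ⟨-, hℓ⟩, -⟩ := Complex.isCoveringMapOn_exp.existsUnique_continuousMap_lifts ⟨f, hf⟩
    (a₀ := 0) (Complex.exp_log (h0 0)) h0
  exact ⟨ℓ, ℓ.continuous, fun p => congrFun hℓ p⟩

/-- A continuous angle that stays in the closed upper half plane, starts on the positive axis and
ends on the negative axis increases by `π`. -/
theorem eq_add_pi_of_sin_nonneg {θ : ℝ → ℝ} (hθ : Continuous θ) {T : ℝ} (hT : 0 ≤ T)
    (hsin₀ : Real.sin (θ 0) = 0) (hcos₀ : 0 < Real.cos (θ 0))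
    (hsin : ∀ u ∈ Icc 0 T, 0 ≤ Real.sin (θ u))
    (hsinT : Real.sin (θ T) = 0) (hcosT : Real.cos (θ T) < 0) : θ T = θ 0 + Real.pi := by
  have hpi := Real.pi_pos
  have hshift : ∀ u, Real.sin (θ u - θ 0) = Real.sin (θ u) * Real.cos (θ 0) := fun u => by
    rw [Real.sin_sub, hsin₀, mul_zero, sub_zero]
  have hnonneg : ∀ u ∈ Icc 0 T, 0 ≤ Real.sin (θ u - θ 0) := fun u hu => by
    rw [hshift]
    exact mul_nonneg (hsin u hu) hcos₀.le
  have hub : θ T ≤ θ 0 + Real.pi := by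
    by_contra! h
    -- The cap at π/2 beyond θ 0 + π selects a value at which the sine, relative to θ 0, is strictly
    -- negative. The lower bound uses the same device below θ 0.
    obtain ⟨u, hu, huθ⟩ := intermediate_value_Icc hT hθ.continuousOn
      (⟨le_min (by linarith) (by linarith), min_le_left _ _⟩ :
        min (θ T) (θ 0 + Real.pi + Real.pi / 2) ∈ Icc (θ 0) (θ T))
    have h2 : θ 0 + Real.pi < θ u := by rw [huθ]; exact lt_min h (by linarith)
    have h3 : θ u ≤ θ 0 + Real.pi + Real.pi / 2 := by rw [huθ]; exact min_le_right _ _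
    have h4 := Real.sin_pos_of_pos_of_lt_pi (x := θ u - θ 0 - Real.pi) (by linarith) (by linarith)
    rw [Real.sin_sub_pi] at h4
    linarith [hnonneg u hu]
  have hlb : θ 0 ≤ θ T := by
    by_contra! h
    obtain ⟨u, hu, huθ⟩ := intermediate_value_Icc' hT hθ.continuousOn
      (⟨le_max_left _ _, max_le h.le (by linarith)⟩ :
        max (θ T) (θ 0 - Real.pi / 2) ∈ Icc (θ T) (θ 0))
    have h2 : θ u < θ 0 := by rw [huθ]; exact max_lt h (by linarith)
    have h3 : θ 0 - Real.pi / 2 ≤ θ u := by rw [huθ]; exact le_max_right _ _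
    have h4 := Real.sin_neg_of_neg_of_neg_pi_lt (x := θ u - θ 0) (by linarith) (by linarith)
    linarith [hnonneg u hu]
  rcases eq_or_lt_of_le hub with h | h
  · exact h
  rcases eq_or_lt_of_le hlb with h' | h'
  · rw [← h'] at hcosT
    linarith
  · have h4 := Real.sin_pos_of_pos_of_lt_pi (x := θ T - θ 0) (by linarith) (by linarith)
    rw [hshift, hsinT, zero_mul] at h4
    exact absurd h4 (lt_irrefl _)

/-- Two continuous polar angles of the same direction differ by a constant. -/
theorem sub_eq_sub_of_exp_eq {θ₁ θ₂ : ℝ → ℝ} (h₁ : Continuous θ₁) (h₂ : Continuous θ₂)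
    (h : ∀ t, Complex.exp (θ₁ t * Complex.I) = Complex.exp (θ₂ t * Complex.I)) (s t : ℝ) :
    θ₁ s - θ₂ s = θ₁ t - θ₂ t := by
  choose n hn using fun t => Complex.exp_eq_exp_iff_exists_int.1 (h t)
  have hn' : ∀ t, θ₁ t - θ₂ t = n t * (2 * Real.pi) := fun t => by
    have := congrArg Complex.im (hn t)
    simp at this
    linarith
  -- The difference is 2π times an integer depending continuously on t, hence constant.
  have hnc : Continuous n := by
    rw [Int.isClosedEmbedding_coe_real.isInducing.continuous_iff]
    have : Int.cast ∘ n = fun t => (θ₁ t - θ₂ t) / (2 * Real.pi) := funext fun t => by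
      rw [hn' t, mul_div_cancel_right₀ _ Real.two_pi_pos.ne', Function.comp_apply]
    rw [this]
    fun_prop
  rw [hn' s, hn' t, PreconnectedSpace.constant inferInstance hnc]

/-- **Hopf's Umlaufsatz**, based at a lowest point of the curve, with tangent pointing to the
right. -/
theorem angle_add_period {γ : ℝ → ℂ} {T : ℝ} (hγ : Differentiable ℝ γ)
    (hγ' : Continuous (deriv γ)) (hT : 0 < T) (hper : Function.Periodic γ T)
    (hreg : ∀ t, deriv γ t ≠ 0) (hinj : InjOn γ (Ico 0 T)) {s₀ : ℝ}
    (hlow : ∀ t, (γ s₀).im ≤ (γ t).im) (him : (deriv γ s₀).im = 0) (hre : 0 < (deriv γ s₀).re)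
    {α : ℝ → ℝ} (hα : Continuous α)
    (hpol : ∀ t, deriv γ t = ‖deriv γ t‖ * Complex.exp (α t * Complex.I)) :
    α (s₀ + T) = α s₀ + 2 * Real.pi := by
  have hcont : Continuous (secant γ T) := by
    unfold secant
    exact (continuous_segmentMean hγ').sub
      ((continuous_segmentMean hγ').comp (by fun_prop : Continuous fun p : ℝ × ℝ =>
        (p.1 + T, p.2 - T)))
  -- Clamping u to [0, T] extends the nonvanishing secant field from the strip to the plane, where
  -- it has a continuous logarithm.
  set clamp : ℝ → ℝ := fun u => max 0 (min T u)
  have hclamp : Continuous clamp := by fun_prop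
  have hmem : ∀ u, clamp u ∈ Icc 0 T := fun u =>
    ⟨le_max_left _ _, max_le hT.le (min_le_left _ _)⟩
  have hclamp_eq : ∀ u ∈ Icc 0 T, clamp u = u := fun u hu => by
    simp only [clamp, min_eq_right hu.2, max_eq_right hu.1]
  obtain ⟨ℓ, hℓc, hℓ⟩ := exists_continuous_exp_eq
    (f := fun p => secant γ T (p.1, clamp p.2)) (by fun_prop)
    (fun p => secant_ne_zero hγ hγ' hT hper hreg hinj p.1 (hmem p.2))
  have hθc : Continuous fun p => (ℓ p).im := Complex.continuous_im.comp hℓc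
  have hsec : ∀ s, ∀ u ∈ Icc 0 T, secant γ T (s, u) = Complex.exp (ℓ (s, u)) := fun s u hu => by
    rw [hℓ]
    simp only [hclamp_eq u hu]
  have h0 : (0 : ℝ) ∈ Icc 0 T := ⟨le_rfl, hT.le⟩
  have hTm : T ∈ Icc 0 T := ⟨hT.le, le_rfl⟩
  have hsin : ∀ s, ∀ u ∈ Icc 0 T,
      (secant γ T (s, u)).im = Real.exp (ℓ (s, u)).re * Real.sin (ℓ (s, u)).im :=
    fun s u hu => by rw [hsec s u hu, Complex.exp_im]
  have hcos : ∀ s, ∀ u ∈ Icc 0 T,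
      (secant γ T (s, u)).re = Real.exp (ℓ (s, u)).re * Real.cos (ℓ (s, u)).im :=
    fun s u hu => by rw [hsec s u hu, Complex.exp_re]
  have hsecim : ∀ s u, u * (T - u) * (secant γ T (s, u)).im =
      T * ((γ (s + u)).im - (γ s).im) := fun s u => by
    have := congrArg Complex.im (secant_mul hγ hγ' hper s u)
    rw [← Complex.ofReal_sub, ← Complex.ofReal_mul, Complex.im_ofReal_mul,
      Complex.im_ofReal_mul, Complex.sub_im] at this
    exact this
  have hz := secant_zero hγ hγ' hT hper
  have hp := secant_period hγ hγ' hT hper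
  have hd := deriv_periodic hper
  -- Chords starting at the lowest point never point downward, so the angle gains π from γ' to -γ'.
  have key1 : (ℓ (s₀, T)).im = (ℓ (s₀, 0)).im + Real.pi := by
    refine eq_add_pi_of_sin_nonneg (θ := fun u => (ℓ (s₀, u)).im)
      (hθc.comp (by fun_prop : Continuous fun u : ℝ => (s₀, u))) hT.le ?_ ?_ (fun u hu => ?_) ?_ ?_
    · have := hsin s₀ 0 h0
      rw [hz, him] at this
      simpa using this.symm
    · have := hcos s₀ 0 h0
      rw [hz] at this
      exact pos_of_mul_pos_right (this ▸ hre) (Real.exp_pos _).le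
    · refine nonneg_of_mul_nonneg_right ((hsin s₀ u hu) ▸ ?_) (Real.exp_pos (ℓ (s₀, u)).re)
      rcases eq_or_lt_of_le hu.1 with rfl | hu0
      · rw [hz, him]
      rcases eq_or_lt_of_le hu.2 with rfl | huT
      · rw [hp, Complex.neg_im, him, neg_zero]
      refine nonneg_of_mul_nonneg_right ?_ (mul_pos hu0 (sub_pos.2 huT))
      rw [hsecim]
      exact mul_nonneg hT.le (sub_nonneg.2 (hlow _))
    · have := hsin s₀ T hTm
      rw [hp, Complex.neg_im, him] at this
      simpa using this.symm
    · have := hcos s₀ T hTm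
      rw [hp, Complex.neg_re] at this
      have h2 : Real.exp (ℓ (s₀, T)).re * Real.cos (ℓ (s₀, T)).im < 0 := by linarith
      exact neg_of_mul_neg_right h2 (Real.exp_pos _).le
  -- Along (s₀ + v, T - v) the chord ends at the lowest point and never points upward; after adding
  -- π to the angle the same lemma gives a second gain of π.
  have key2 : (ℓ (s₀ + T, 0)).im + Real.pi = (ℓ (s₀, T)).im + Real.pi + Real.pi := by
    have := eq_add_pi_of_sin_nonneg (θ := fun v => (ℓ (s₀ + v, T - v)).im + Real.pi)
      ((hθc.comp (by fun_prop : Continuous fun v : ℝ => (s₀ + v, T - v))).add_const _) hT.le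
      ?_ ?_ (fun v hv => ?_) ?_ ?_
    · simpa using this
    · have := hsin s₀ T hTm
      rw [hp, Complex.neg_im, him] at this
      simpa [Real.sin_add_pi] using this.symm
    · have := hcos s₀ T hTm
      rw [hp, Complex.neg_re] at this
      have h2 : Real.exp (ℓ (s₀, T)).re * Real.cos (ℓ (s₀, T)).im < 0 := by linarith
      simpa [Real.cos_add_pi] using neg_of_mul_neg_right h2 (Real.exp_pos _).le
    · have hv' : T - v ∈ Icc 0 T := ⟨by linarith [hv.2], by linarith [hv.1]⟩
      rw [Real.sin_add_pi, neg_nonneg]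
      refine nonpos_of_mul_nonpos_right ((hsin (s₀ + v) (T - v) hv') ▸ ?_)
        (Real.exp_pos (ℓ (s₀ + v, T - v)).re)
      rcases eq_or_lt_of_le hv.1 with rfl | hv0
      · rw [add_zero, sub_zero, hp, Complex.neg_im, him, neg_zero]
      rcases eq_or_lt_of_le hv.2 with rfl | hvT
      · rw [sub_self, hz, hd, him]
      have h1 := hsecim (s₀ + v) (T - v)
      rw [show s₀ + v + (T - v) = s₀ + T by ring, hper] at h1
      have h2 : 0 < (T - v) * (T - (T - v)) := mul_pos (by linarith) (by linarith)
      refine nonpos_of_mul_nonpos_right (h1 ▸ ?_) h2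
      exact mul_nonpos_of_nonneg_of_nonpos hT.le (sub_nonpos.2 (hlow _))
    · have := hsin (s₀ + T) 0 h0
      rw [hz, hd, him] at this
      simpa [Real.sin_add_pi] using this.symm
    · have := hcos (s₀ + T) 0 h0
      rw [hz, hd] at this
      simpa [Real.cos_add_pi] using pos_of_mul_pos_right (this ▸ hre) (Real.exp_pos _).le
  have hexp : ∀ t, Complex.exp (α t * Complex.I) = Complex.exp ((ℓ (t, 0)).im * Complex.I) :=
    fun t => by
      have h1 : deriv γ t = Complex.exp (ℓ (t, 0)) := (hz t).symm.trans (hsec t 0 h0)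
      have h2 : deriv γ t = ‖deriv γ t‖ * Complex.exp ((ℓ (t, 0)).im * Complex.I) := by
        rw [h1, Complex.norm_exp, Complex.ofReal_exp, ← Complex.exp_add, Complex.re_add_im]
      exact mul_left_cancel₀ (by simpa using hreg t) ((hpol t).symm.trans h2)
  have := sub_eq_sub_of_exp_eq hα
    (hθc.comp (by fun_prop : Continuous fun t : ℝ => (t, (0 : ℝ)))) hexp (s₀ + T) s₀
  simp only [Function.comp_apply] at this
  linarith

/-- A smooth polar angle of the velocity of a regular curve. -/
theorem exists_polar_angle {γ : ℝ → ℂ} (hγ : ContDiff ℝ (⊤ : ℕ∞) γ) (hreg : ∀ t, deriv γ t ≠ 0) :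
    ∃ α α' : ℝ → ℝ, (∀ t, HasDerivAt α (α' t) t) ∧ Continuous α' ∧
      ∀ t, deriv γ t = ‖deriv γ t‖ * Complex.exp (α t * Complex.I) := by
  have hγ' : ContDiff ℝ (⊤ : ℕ∞) (deriv γ) := (contDiff_infty_iff_deriv.1 hγ).2
  have hd : ∀ t, HasDerivAt (deriv γ) (deriv (deriv γ) t) t := fun t =>
    (hγ'.differentiable (by simp) t).hasDerivAt
  set f : ℝ → ℂ := fun t => deriv (deriv γ) t / deriv γ t
  have hf : Continuous f := (hγ'.continuous_deriv (by simp)).div hγ'.continuous hreg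
  set ℓ : ℝ → ℂ := fun t => Complex.log (deriv γ 0) + ∫ s in (0 : ℝ)..t, f s
  have hℓ : ∀ t, HasDerivAt ℓ (f t) t := fun t =>
    (intervalIntegral.integral_hasDerivAt_right (hf.intervalIntegrable _ _)
      (hf.stronglyMeasurableAtFilter _ _) hf.continuousAt).const_add _
  -- ℓ integrates γ''/γ' from a logarithm of γ' 0, so γ' e^{-ℓ} is constant and equals 1.
  have hE : ∀ t, HasDerivAt (fun t => deriv γ t * Complex.exp (-ℓ t)) 0 t := fun t => by
    convert! (hd t).mul (hℓ t).neg.cexp using 1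
    simp only [f]
    field_simp [hreg t]
    ring
  have hexp : ∀ t, deriv γ t = Complex.exp (ℓ t) := fun t => by
    have h1 := is_const_of_deriv_eq_zero (fun t => (hE t).differentiableAt)
      (fun t => (hE t).deriv) t 0
    have h2 : ℓ 0 = Complex.log (deriv γ 0) := by simp [ℓ]
    rw [h2, Complex.exp_neg, Complex.exp_neg, Complex.exp_log (hreg 0), mul_inv_cancel₀ (hreg 0),
      mul_inv_eq_one₀ (Complex.exp_ne_zero _)] at h1
    exact h1
  refine ⟨fun t => (ℓ t).im, fun t => (f t).im,
    fun t => Complex.imCLM.hasFDerivAt.comp_hasDerivAt t (hℓ t),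
    Complex.continuous_im.comp hf, fun t => ?_⟩
  rw [hexp, Complex.norm_exp, Complex.ofReal_exp, ← Complex.exp_add, Complex.re_add_im]

/-! ### Orientation read off at a lowest point -/

theorem exists_lowest_point {γ : ℝ → ℂ} {T : ℝ} (h : IsSimpleClosedCurve γ T) :
    ∃ s₀, ∀ t, (γ s₀).im ≤ (γ t).im := by
  obtain ⟨s₀, -, hs₀⟩ := (isCompact_Icc (a := (0 : ℝ)) (b := T)).exists_isMinOn
    ⟨0, le_rfl, h.period_pos.le⟩
    (Complex.continuous_im.comp h.smooth.continuous).continuousOn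
  refine ⟨s₀, fun t => ?_⟩
  obtain ⟨y, hy, hty⟩ := h.periodic.exists_mem_Ico₀ h.period_pos t
  rw [hty]
  exact hs₀ (Ico_subset_Icc_self hy)

/-- Points below a curve are not in its interior. -/
theorem notMem_insideOf_of_im_lt {γ : ℝ → ℂ} {y : ℝ} (hy : ∀ t, y ≤ (γ t).im) {z : ℂ}
    (hz : z.im < y) : z ∉ insideOf γ := by
  rintro ⟨-, hb⟩
  -- The half plane below the curve is connected and misses it, so it lies in the component of z,
  -- which is therefore unbounded.
  have hsub : {w : ℂ | w.im < y} ⊆ connectedComponentIn (range γ)ᶜ z :=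
    (convex_halfSpace_im_lt y).isPreconnected.subset_connectedComponentIn hz (by
      rintro w hw ⟨t, rfl⟩
      exact absurd (hy t) (not_le.2 hw))
  obtain ⟨M, hM⟩ := (hb.subset hsub).exists_norm_le
  have h1 := hM ⟨0, min y 0 - |M| - 1⟩
    (show min y 0 - |M| - 1 < y by linarith [min_le_left y 0, abs_nonneg M])
  have h2 := Complex.abs_im_le_norm ⟨0, min y 0 - |M| - 1⟩
  have h3 := neg_le_abs (min y 0 - |M| - 1)
  simp only at h2
  linarith [min_le_right y 0, le_abs_self M]

section

variable {γ : ℝ → ℂ} {s₀ : ℝ}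

theorem deriv_im_eq_zero_of_lowest (hγ : Differentiable ℝ γ) (hlow : ∀ t, (γ s₀).im ≤ (γ t).im) :
    (deriv γ s₀).im = 0 := by
  have h1 : HasDerivAt (fun t => (γ t).im) (deriv γ s₀).im s₀ :=
    Complex.imCLM.hasFDerivAt.comp_hasDerivAt s₀ (hγ s₀).hasDerivAt
  exact IsLocalMin.hasDerivAt_eq_zero (.of_forall hlow) h1

/-- If the horizontal tangent pointed left, its left-hand side would lie below the whole curve,
hence outside the interior. -/
theorem re_deriv_pos_of_isPositivelyOriented (hreg : deriv γ s₀ ≠ 0)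
    (hlow : ∀ t, (γ s₀).im ≤ (γ t).im) (him : (deriv γ s₀).im = 0)
    (ho : IsPositivelyOriented γ) : 0 < (deriv γ s₀).re := by
  by_contra! h
  have hne : (deriv γ s₀).re ≠ 0 := fun h0 => hreg (Complex.ext h0 him)
  obtain ⟨s, hs, hs0⟩ := ((ho s₀).and self_mem_nhdsWithin).exists
  refine notMem_insideOf_of_im_lt hlow ?_ hs
  have := mul_neg_of_pos_of_neg (mem_Ioi.1 hs0) (lt_of_le_of_ne h hne)
  simpa using this

theorem re_deriv_neg_of_isNegativelyOriented (hreg : deriv γ s₀ ≠ 0)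
    (hlow : ∀ t, (γ s₀).im ≤ (γ t).im) (him : (deriv γ s₀).im = 0)
    (ho : IsNegativelyOriented γ) : (deriv γ s₀).re < 0 := by
  by_contra! h
  have hne : (deriv γ s₀).re ≠ 0 := fun h0 => hreg (Complex.ext h0 him)
  obtain ⟨s, hs, hs0⟩ := ((ho s₀).and self_mem_nhdsWithin).exists
  refine notMem_insideOf_of_im_lt hlow ?_ hs
  have := mul_pos (mem_Ioi.1 hs0) (lt_of_le_of_ne h hne.symm)
  simpa using this

end

/-- α(· + T) and α are continuous angles of the same periodic direction, so the turning over a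
period does not depend on its starting point. -/
theorem angle_period_eq {γ : ℝ → ℂ} {T : ℝ} (h : IsSimpleClosedCurve γ T) {α : ℝ → ℝ}
    (hα : Continuous α)
    (hpol : ∀ t, deriv γ t = ‖deriv γ t‖ * Complex.exp (α t * Complex.I)) (s : ℝ) :
    α T - α 0 = α (s + T) - α s := by
  have h1 := sub_eq_sub_of_exp_eq (θ₁ := fun t => α (t + T)) (θ₂ := α) (by fun_prop) hα
    (fun t => by
      have h2 := hpol (t + T)
      rw [deriv_periodic h.periodic t] at h2
      exact mul_left_cancel₀ (by simpa using h.regular t) (h2.symm.trans (hpol t))) 0 s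
  simpa using h1

theorem angle_period_of_isPositivelyOriented {γ : ℝ → ℂ} {T : ℝ} (h : IsSimpleClosedCurve γ T)
    (ho : IsPositivelyOriented γ) {α : ℝ → ℝ} (hα : Continuous α)
    (hpol : ∀ t, deriv γ t = ‖deriv γ t‖ * Complex.exp (α t * Complex.I)) :
    α T = α 0 + 2 * Real.pi := by
  obtain ⟨s₀, hlow⟩ := exists_lowest_point h
  have hd := h.smooth.differentiable (by simp)
  have him := deriv_im_eq_zero_of_lowest hd hlow
  have h1 := angle_add_period hd (h.smooth.continuous_deriv (by simp)) h.period_pos h.periodic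
    h.regular h.simple hlow him
    (re_deriv_pos_of_isPositivelyOriented (h.regular s₀) hlow him ho) hα hpol
  linarith [angle_period_eq h hα hpol s₀]

theorem angle_period_of_isNegativelyOriented {γ : ℝ → ℂ} {T : ℝ} (h : IsSimpleClosedCurve γ T)
    (ho : IsNegativelyOriented γ) {α : ℝ → ℝ} (hα : Continuous α)
    (hpol : ∀ t, deriv γ t = ‖deriv γ t‖ * Complex.exp (α t * Complex.I)) :
    α T + 2 * Real.pi = α 0 := by
  obtain ⟨s₀, hlow⟩ := exists_lowest_point h
  have hd := h.smooth.differentiable (by simp)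
  have him := deriv_im_eq_zero_of_lowest hd hlow
  have hre := re_deriv_neg_of_isNegativelyOriented (h.regular s₀) hlow him ho
  -- Reflection in the imaginary axis keeps heights, turns the leftward tangent at the lowest point
  -- to the right, and replaces α by π - α.
  set β : ℝ → ℂ := fun t => -(starRingEnd ℂ) (γ t)
  have hβd : ∀ t, HasDerivAt β (-(starRingEnd ℂ) (deriv γ t)) t := fun t =>
    (Complex.conjCLE.toContinuousLinearMap.hasFDerivAt.comp_hasDerivAt t (hd t).hasDerivAt).neg
  have hβ : deriv β = fun t => -(starRingEnd ℂ) (deriv γ t) := funext fun t => (hβd t).deriv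
  have h1 := angle_add_period (γ := β) (T := T) (s₀ := s₀) (α := fun t => Real.pi - α t)
    (fun t => (hβd t).differentiableAt)
    (by
      rw [hβ]
      exact (Complex.continuous_conj.comp (h.smooth.continuous_deriv (by simp))).neg)
    h.period_pos (fun t => by simp only [β, h.periodic t])
    (fun t => by simpa [hβ] using h.regular t)
    (fun s hs t ht hst => h.simple hs ht ((starRingEnd ℂ).injective (neg_injective hst)))
    (fun t => by simpa [β] using hlow t) (by simpa [hβ] using him) (by simpa [hβ] using hre)
    (by fun_prop)
    (fun t => by
      rw [hβ]
      simp only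
      rw [norm_neg, Complex.norm_conj]
      conv_lhs => rw [hpol t, map_mul, Complex.conj_ofReal, ← Complex.exp_conj, map_mul,
        Complex.conj_ofReal, Complex.conj_I]
      push_cast
      rw [sub_mul, Complex.exp_sub, Complex.exp_pi_mul_I, mul_neg, Complex.exp_neg]
      ring)
  linarith [angle_period_eq h hα hpol s₀]

end MagneticCrofton

end

/-! ### Assembly of the length formula -/

theorem mainTheorem6 (R : ℝ) (hR : 0 < R) (g a b : ℂ → ℝ)
    (hgab : MagneticCrofton.IsMagneticData R g a b) :
    ∃ C : ℝ,
      (∀ c : ℂ, MagneticCrofton.finslerLength (MagneticCrofton.lagrangian R g a b)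
        (circleMap c R) (2 * Real.pi) = C) ∧
      ∀ (γ : ℝ → ℂ) (T : ℝ), MagneticCrofton.IsSimpleClosedCurve γ T →
        (MagneticCrofton.IsPositivelyOriented γ →
          MagneticCrofton.finslerLength (MagneticCrofton.lagrangian R g a b) γ T =
            MagneticCrofton.signedArea (MagneticCrofton.omegaDensity R g)
              (MagneticCrofton.parallelCurve γ (-R)) T + C) ∧
        (MagneticCrofton.IsNegativelyOriented γ →
          MagneticCrofton.finslerLength (MagneticCrofton.lagrangian R g a b) γ T =
            MagneticCrofton.signedArea (MagneticCrofton.omegaDensity R g)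
              (MagneticCrofton.parallelCurve γ (-R)) T - C) := by
  obtain ⟨F, hF, C, hC⟩ := MagneticCrofton.exists_primitive_reducedHilbertForm hR hgab
  refine ⟨C, MagneticCrofton.finslerLength_circleMap hR hgab hF hC, fun γ T hγ => ?_⟩
  obtain ⟨α, α', hα, hα', hpol⟩ := MagneticCrofton.exists_polar_angle hγ.smooth hγ.regular
  have hαc : Continuous α := continuous_iff_continuousAt.2 fun t => (hα t).continuousAt
  rw [MagneticCrofton.finslerLength_eq_signedArea_add hR hgab hF hγ.smooth hγ.regular hα hα' hpol]
  have hT : γ T = γ 0 := by simpa using hγ.periodic 0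
  refine ⟨fun ho => ?_, fun ho => ?_⟩
  · have h := hC (γ 0, α 0)
    rw [Prod.mk_add_mk, add_zero,
      ← MagneticCrofton.angle_period_of_isPositivelyOriented hγ ho hαc hpol] at h
    rw [hT]
    linarith
  -- In the clockwise case α T is the smaller angle, so the shift by 2π starts there and F decreases
  -- by C.
  · have h := hC (γ 0, α T)
    rw [Prod.mk_add_mk, add_zero,
      MagneticCrofton.angle_period_of_isNegativelyOriented hγ ho hαc hpol] at h
    rw [hT]
    linarith
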